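/- Let $n\in\mathbb{N}=\{0,1,2,\dots\}$. Let $X=\begin{bmatrix}0&1\\1&0\end{bmatrix}$, $H=\frac1{\sqrt2}\begin{bmatrix}1&1\\1&-1\end{bmatrix}$, $CX=I_2\oplus X$ and $CCX=I_6\oplus X$. A circuit on $k$ qubits over $\{X,CX,CCX,H\}$ is a finite composition of these gates, each applied to distinct qubits among the $k$ and tensored with the identity on the other qubits; the empty composition is the identity. A complex $2^n\times 2^n$ matrix $V$ is exactly represented by a circuit $D$ on $n+m$ qubits using $m$ (clean) ancillas if $D\,|\psi\rangle|0\rangle^{\otimes m}=(V|\psi\rangle)|0\rangle^{\otimes m}$ for every $n$-qubit state $|\psi\rangle$; it is exactly representable if this holds for some $m\in\mathbb{N}$ and some $D$. 1. A complex $2^n\times2^n$ matrix $V$ is exactly representable by a circuit over $\{X,CX,CCX,H\}$ if and only if $V$ is unitary and $V=W/\sqrt2^{\,q}$ for some integer matrix $W$ and some $q\in\mathbb{N}$. 2. Every such $V$ is exactly represented by a circuit over $\{X,CX,CCX,H\}$ using a single ancilla. 3. If $d$ is odd, no unitary $d\times d$ matrix is of the form $W/\sqrt2^{\,q}$ with $W$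 an integer matrix and $q$ odd. -/

import Mathlib

namespace QCirc

/-- Labels of the computational basis of `n` qubits: bit strings of length `n`
(there are `2 ^ n` of them; wire `0` is the top wire, i.e. the leftmost tensor factor). -/
abbrev Bits (n : ℕ) : Type := Fin n → Fin 2

/-- Complex `2 ^ n × 2 ^ n` matrices, with rows and columns labelled by the computational basis. -/
abbrev QMat (n : ℕ) : Type := Matrix (Bits n) (Bits n) ℂ

/-- Vectors of the state space of `n` qubits. -/
abbrev QVec (n : ℕ) : Type := Bits n → ℂ

/-- A gate: a matrix acting on some number of qubits. -/
structure Gate where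
  arity : ℕ
  mat : QMat arity

/-- A `2 × 2` matrix seen as a matrix on one qubit. -/
def oneQubit (A : Matrix (Fin 2) (Fin 2) ℂ) : QMat 1 :=
  A.submatrix (fun x => x 0) (fun y => y 0)

/-- The controlled matrix `I ⊕ U`: it acts as `U` on the wires `1, …, k` if wire `0` carries `1`,
and as the identity if wire `0` carries `0`. -/
def controlled {k : ℕ} (U : QMat k) : QMat (k + 1) :=
  fun x y =>
    if x 0 = 1 ∧ y 0 = 1 then U (Fin.tail x) (Fin.tail y)
    else if x = y then 1 else 0

def gateX : Gate := ⟨1, oneQubit !![0, 1; 1, 0]⟩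

def gateCX : Gate := ⟨2, controlled gateX.mat⟩

def gateCCX : Gate := ⟨3, controlled gateCX.mat⟩

noncomputable def gateH : Gate :=
  ⟨1, oneQubit ((1 / (Real.sqrt 2 : ℂ)) • !![1, 1; 1, -1])⟩

/-- The matrix on `n` qubits that applies `U` to the wires `e 0, …, e (k - 1)` (in this order) and
the identity to the other wires, that is, `U ⊗ I` up to the placement of the wires. -/
noncomputable def onWires {k n : ℕ} (e : Fin k ↪ Fin n) (U : QMat k) : QMat n :=
  open Classical in
  fun x y => if ∀ j, j ∉ Set.range e → x j = y j then U (x ∘ e) (y ∘ e) else 0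

/-- Circuits on `n` wires over a gate set `G`: gates from `G`, each placed on distinct wires
(tensored with the identity on the remaining wires), and their compositions. -/
inductive Circuit (G : Set Gate) (n : ℕ) : Type
  | id : Circuit G n
  | gate (g : Gate) (hg : g ∈ G) (e : Fin g.arity ↪ Fin n) : Circuit G n
  | comp (C D : Circuit G n) : Circuit G n

/-- The matrix of a circuit; in `comp C D` the circuit `D` is applied first. -/
noncomputable def Circuit.eval {G : Set Gate} {n : ℕ} : Circuit G n → QMat n
  | .id => 1
  | .gate g _ e => onWires e g.mat
  | .comp C D => C.eval * D.eval

/-- The tensor product of a vector on the first `n` wires and a vector on the last `m` wires. -/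
def tensorVec {n m : ℕ} (ψ : QVec n) (φ : QVec m) : QVec (n + m) :=
  fun z => ψ (fun i => z (Fin.castAdd m i)) * φ (fun j => z (Fin.natAdd n j))

/-- The basis state `|0⟩^{⊗ m}`. -/
def ketZero (m : ℕ) : QVec m := Pi.single 0 1

/-- The circuit `D` represents `V` exactly, using the last `m` wires as clean ancillas:
`D |ψ⟩|0⟩^{⊗ m} = (V |ψ⟩)|0⟩^{⊗ m}` for all `ψ` (by linearity it does not matter whether `ψ` is
required to have norm one). -/
def Represents {G : Set Gate} {n m : ℕ} (D : Circuit G (n + m)) (V : QMat n) : Prop :=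
  ∀ ψ : QVec n,
    D.eval.mulVec (tensorVec ψ (ketZero m)) = tensorVec (V.mulVec ψ) (ketZero m)

/-- `V` is exactly represented by a circuit over `G` using `m` clean ancillas. -/
def RepresentableWith (G : Set Gate) (m : ℕ) {n : ℕ} (V : QMat n) : Prop :=
  ∃ D : Circuit G (n + m), Represents D V

/-- `V` is exactly represented by a circuit over `G`, using some number of clean ancillas. -/
def Representable (G : Set Gate) {n : ℕ} (V : QMat n) : Prop :=
  ∃ m : ℕ, RepresentableWith G m V

/-- `V = W / √2 ^ q` for some integer matrix `W`. -/
def IsIntMatrixDivSqrtTwoPow {ι : Type*} (V : Matrix ι ι ℂ) (q : ℕ) : Prop :=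
  ∃ W : Matrix ι ι ℤ, V = (1 / (Real.sqrt 2 : ℂ) ^ q) • W.map (fun a : ℤ => (a : ℂ))

/-- The gate set `{X, CX, CCX, H}`. -/
def toffoliHadamard : Set Gate := {gateX, gateCX, gateCCX, gateH}

end QCirc

/-! Necessity: gate matrices, placed on any wires, are unitary and integral up to a power of `√2`,
and both properties survive products (`Circuit.eval_properties`). A represented `V` is the block of
the circuit matrix on the labels with zero ancillas. The columns through that block vanish outside
it, so `V` inherits unitarity as well as integrality.

Sufficiency: if `q` is odd and there is a wire, one Hadamard makes the exponent even, leaving a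
unitary `V = W / 2 ^ k`. Columns are turned into basis vectors one at a time. An integer column of
squared norm `4 ^ k` with `k > 0` has a multiple of four odd entries. After a possible sign change,
reflecting in half the sum of four basis vectors makes four of these even, and once all are even a
factor 2 cancels. At `k = 0` the column is a signed basis vector (`mem_of_fixesOn_step`). So
permutations, sign changes and these reflections suffice.

All three come from the gates. A borrowed wire, left unchanged at the end, gives multiply controlled
flips (`ctrlFlip_insert`), and hence every permutation of the basis. Conjugating a transposition by
a Hadamard gives a sign change, and conjugating that by two Hadamards gives a four-term reflection.
The single ancilla is the borrowed wire: the circuit is `V ⊗ I`, whatever the ancilla holds.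

Odd dimension: the determinant is real of modulus one, so `(det W) ^ 2 = 2 ^ (q * d)` and `q * d` is
even. -/

namespace QCirc

open Matrix

/-! ### Matrices of maps on labels, and placement on wires -/

/-- The matrix of the operator `ψ ↦ ψ ∘ f`. -/
def funMat {ι : Type*} [DecidableEq ι] (f : ι → ι) : Matrix ι ι ℂ :=
  (1 : Matrix ι ι ℂ).submatrix f id

theorem funMat_apply {ι : Type*} [DecidableEq ι] (f : ι → ι) (x y : ι) :
    funMat f x y = if f x = y then 1 else 0 := by
  simp [funMat, Matrix.one_apply]

theorem funMat_mul {ι : Type*} [DecidableEq ι] [Fintype ι] (f : ι → ι) (M : Matrix ι ι ℂ) :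
    funMat f * M = M.submatrix f id := by
  ext x y
  simp [Matrix.mul_apply, funMat_apply]

theorem funMat_mul_funMat {ι : Type*} [DecidableEq ι] [Fintype ι] (f g : ι → ι) :
    funMat f * funMat g = funMat (g ∘ f) := by
  rw [funMat_mul]; rfl

theorem funMat_id {ι : Type*} [DecidableEq ι] : funMat (id : ι → ι) = 1 := by
  simp [funMat]

theorem funMat_transpose_of_involutive {ι : Type*} [DecidableEq ι] {f : ι → ι}
    (hf : Function.Involutive f) : (funMat f)ᵀ = funMat f := by
  ext x y
  simp only [transpose_apply, funMat_apply]
  congr 1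
  rw [eq_comm (a := f x), hf.eq_iff, eq_iff_iff]

theorem onWires_apply {k n : ℕ} (e : Fin k ↪ Fin n) (U : QMat k) (x y : Bits n) :
    onWires e U x y =
      open Classical in if ∀ j, j ∉ Set.range e → x j = y j then U (x ∘ e) (y ∘ e) else 0 := rfl

theorem onWires_apply_of_eq {k n : ℕ} (e : Fin k ↪ Fin n) (U : QMat k) {x y : Bits n}
    (h : ∀ j, j ∉ Set.range e → x j = y j) : onWires e U x y = U (x ∘ e) (y ∘ e) := by
  classical
  rw [onWires_apply, if_pos h]

theorem onWires_apply_of_ne {k n : ℕ} (e : Fin k ↪ Fin n) (U : QMat k) {x y : Bits n}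
    (h : ¬ ∀ j, j ∉ Set.range e → x j = y j) : onWires e U x y = 0 := by
  classical
  rw [onWires_apply, if_neg h]

theorem eq_of_comp_eq_of_eq_off {k n : ℕ} (e : Fin k ↪ Fin n) {x y : Bits n}
    (h : ∀ j, j ∉ Set.range e → x j = y j) (h' : x ∘ e = y ∘ e) : x = y := by
  funext j
  by_cases hj : j ∈ Set.range e
  · obtain ⟨i, rfl⟩ := hj
    exact congrFun h' i
  · exact h j hj

/-- Only intermediate labels that agree with `x` off the range of `e` contribute. They are the
strings `Function.extend e u x`, one for each `u`, so the sum becomes that of the small product. -/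
theorem onWires_mul {k n : ℕ} (e : Fin k ↪ Fin n) (U V : QMat k) :
    onWires e (U * V) = onWires e U * onWires e V := by
  classical
  ext x z
  rw [Matrix.mul_apply]
  by_cases h : ∀ j, j ∉ Set.range e → x j = z j
  · rw [onWires_apply_of_eq e _ h, Matrix.mul_apply]
    refine Finset.sum_of_injOn (fun u => Function.extend e u x) ?_ (by simp) ?_ ?_
    · intro u _ v _ huv
      funext i
      have := congrFun huv (e i)
      simpa [e.injective.extend_apply] using this
    · intro y _ hy
      by_cases hxy : ∀ j, j ∉ Set.range e → x j = y j
      · refine absurd ⟨y ∘ e, by simp, ?_⟩ hy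
        refine eq_of_comp_eq_of_eq_off e (fun j hj => ?_)
          (funext fun i => e.injective.extend_apply _ _ i)
        exact (Function.extend_apply' _ _ _ (by simpa using hj)).trans (hxy j hj)
      · rw [onWires_apply_of_ne e _ hxy, zero_mul]
    · intro u _
      have hu : ∀ j, j ∉ Set.range e → Function.extend e u x j = x j := fun j hj =>
        Function.extend_apply' _ _ _ (by simpa using hj)
      rw [onWires_apply_of_eq e U fun j hj => (hu j hj).symm,
        onWires_apply_of_eq e V fun j hj => (hu j hj).trans (h j hj),
        (funext fun i => e.injective.extend_apply u x i : Function.extend e u x ∘ e = u)]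
  · rw [onWires_apply_of_ne e _ h]
    symm
    refine Finset.sum_eq_zero fun y _ => ?_
    by_cases hxy : ∀ j, j ∉ Set.range e → x j = y j
    · rw [onWires_apply_of_ne e V fun hyz => h fun j hj => (hxy j hj).trans (hyz j hj), mul_zero]
    · rw [onWires_apply_of_ne e U hxy, zero_mul]

theorem onWires_one {k n : ℕ} (e : Fin k ↪ Fin n) : onWires e (1 : QMat k) = 1 := by
  ext x y
  by_cases h : ∀ j, j ∉ Set.range e → x j = y j
  · rw [onWires_apply_of_eq e _ h, Matrix.one_apply, Matrix.one_apply]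
    congr 1
    exact propext ⟨fun h' => eq_of_comp_eq_of_eq_off e h h', fun h' => by rw [h']⟩
  · rw [onWires_apply_of_ne e _ h, Matrix.one_apply_ne]
    rintro rfl
    exact h fun _ _ => rfl

theorem onWires_trans {k m n : ℕ} (f : Fin k ↪ Fin m) (e : Fin m ↪ Fin n) (U : QMat k) :
    onWires e (onWires f U) = onWires (f.trans e) U := by
  ext x y
  by_cases h : ∀ j, j ∉ Set.range e → x j = y j
  · rw [onWires_apply_of_eq e _ h]
    by_cases h' : ∀ i, i ∉ Set.range f → (x ∘ e) i = (y ∘ e) i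
    · rw [onWires_apply_of_eq f _ h', onWires_apply_of_eq]
      · rfl
      · intro j hj
        by_cases hj' : j ∈ Set.range e
        · obtain ⟨i, rfl⟩ := hj'
          refine h' i ?_
          rintro ⟨l, rfl⟩
          exact hj ⟨l, rfl⟩
        · exact h j hj'
    · rw [onWires_apply_of_ne f _ h', onWires_apply_of_ne]
      refine fun H => h' fun i hi => H _ ?_
      rintro ⟨l, hl⟩
      exact hi ⟨l, e.injective hl⟩
  · rw [onWires_apply_of_ne e _ h, onWires_apply_of_ne]
    refine fun H => h fun j hj => H j ?_
    rintro ⟨l, rfl⟩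
    exact hj ⟨f l, rfl⟩

theorem onWires_conjTranspose {k n : ℕ} (e : Fin k ↪ Fin n) (U : QMat k) :
    (onWires e U)ᴴ = onWires e Uᴴ := by
  ext x y
  rw [conjTranspose_apply]
  by_cases h : ∀ j, j ∉ Set.range e → x j = y j
  · rw [onWires_apply_of_eq e _ h, onWires_apply_of_eq e _ fun j hj => (h j hj).symm,
      conjTranspose_apply]
  · rw [onWires_apply_of_ne e _ h, onWires_apply_of_ne e, star_zero]
    exact fun H => h fun j hj => (H j hj).symm

theorem onWires_mem_unitaryGroup {k n : ℕ} (e : Fin k ↪ Fin n) {U : QMat k}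
    (hU : U ∈ unitaryGroup (Bits k) ℂ) : onWires e U ∈ unitaryGroup (Bits n) ℂ := by
  rw [mem_unitaryGroup_iff, star_eq_conjTranspose] at hU ⊢
  rw [onWires_conjTranspose, ← onWires_mul, hU, onWires_one]

/-! ### Controlled bit flips and integrality -/

/-- Flip the bit `t` of a bit string if all its bits in `A` are `1`. -/
def ctrlFlip {n : ℕ} (A : Finset (Fin n)) (t : Fin n) (x : Bits n) : Bits n :=
  if ∀ a ∈ A, x a = 1 then x + Pi.single t 1 else x

theorem ctrlFlip_apply_of_ne {n : ℕ} (A : Finset (Fin n)) {t j : Fin n} (h : j ≠ t)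
    (x : Bits n) : ctrlFlip A t x j = x j := by
  unfold ctrlFlip
  split_ifs <;> simp [h]

theorem ctrlFlip_apply_self {n : ℕ} (A : Finset (Fin n)) (t : Fin n) (x : Bits n) :
    ctrlFlip A t x t = if ∀ a ∈ A, x a = 1 then x t + 1 else x t := by
  unfold ctrlFlip
  split_ifs <;> simp

theorem onWires_funMat_ctrlFlip {k n : ℕ} (e : Fin k ↪ Fin n) (A : Finset (Fin k)) (t : Fin k) :
    onWires e (funMat (ctrlFlip A t)) = funMat (ctrlFlip (A.map e) (e t)) := by
  have key : ∀ x : Bits n, ctrlFlip (A.map e) (e t) x ∘ e = ctrlFlip A t (x ∘ e) := by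
    intro x
    funext i
    by_cases hi : i = t
    · subst hi
      simp [ctrlFlip_apply_self]
    · rw [Function.comp_apply, ctrlFlip_apply_of_ne _ (e.injective.ne hi),
        ctrlFlip_apply_of_ne _ hi, Function.comp_apply]
  have off : ∀ (x : Bits n) j, j ∉ Set.range e → ctrlFlip (A.map e) (e t) x j = x j :=
    fun x j hj => ctrlFlip_apply_of_ne _ (fun h => hj ⟨t, h.symm⟩) x
  ext x y
  by_cases h : ∀ j, j ∉ Set.range e → x j = y j
  · rw [onWires_apply_of_eq e _ h, funMat_apply, funMat_apply, ← key]
    congr 1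
    refine propext ⟨fun h' => eq_of_comp_eq_of_eq_off e (fun j hj => ?_) h', fun h' => by rw [h']⟩
    rw [off x j hj, h j hj]
  · rw [onWires_apply_of_ne e _ h, funMat_apply, if_neg]
    rintro rfl
    exact h fun j hj => (off x j hj).symm

theorem IsIntMatrixDivSqrtTwoPow.mul {ι : Type*} [Fintype ι] {U V : Matrix ι ι ℂ} {p q : ℕ}
    (hU : IsIntMatrixDivSqrtTwoPow U p) (hV : IsIntMatrixDivSqrtTwoPow V q) :
    IsIntMatrixDivSqrtTwoPow (U * V) (p + q) := by
  obtain ⟨A, rfl⟩ := hU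
  obtain ⟨B, rfl⟩ := hV
  refine ⟨A * B, ?_⟩
  have : (A * B).map (fun a : ℤ => (a : ℂ))
      = A.map (fun a : ℤ => (a : ℂ)) * B.map (fun a : ℤ => (a : ℂ)) :=
    Matrix.map_mul (f := Int.castRingHom ℂ)
  rw [this, smul_mul_assoc, mul_smul_comm, smul_smul, pow_add]
  congr 1
  rw [one_div_mul_one_div]

theorem IsIntMatrixDivSqrtTwoPow.onWires {k n : ℕ} (e : Fin k ↪ Fin n) {U : QMat k} {q : ℕ}
    (hU : IsIntMatrixDivSqrtTwoPow U q) : IsIntMatrixDivSqrtTwoPow (onWires e U) q := by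
  classical
  obtain ⟨A, rfl⟩ := hU
  refine ⟨Matrix.of fun x y =>
    if ∀ j, j ∉ Set.range e → x j = y j then A (x ∘ e) (y ∘ e) else 0, ?_⟩
  ext x y
  by_cases h : ∀ j, j ∉ Set.range e → x j = y j
  · rw [onWires_apply_of_eq e _ h]
    simp only [Matrix.smul_apply, map_apply, of_apply, if_pos h]
  · rw [onWires_apply_of_ne e _ h]
    simp only [Matrix.smul_apply, map_apply, of_apply, if_neg h, Int.cast_zero, smul_zero]

theorem isIntMatrixDivSqrtTwoPow_funMat {ι : Type*} [DecidableEq ι] (f : ι → ι) :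
    IsIntMatrixDivSqrtTwoPow (funMat f) 0 := by
  refine ⟨(1 : Matrix ι ι ℤ).submatrix f id, ?_⟩
  ext x y
  simp [funMat_apply, Matrix.one_apply]

theorem oneQubit_flip :
    oneQubit !![0, 1; 1, 0] = funMat (ctrlFlip (∅ : Finset (Fin 1)) 0) := by
  have h : ∀ x : Bits 1, ctrlFlip ∅ 0 x = fun _ => x 0 + 1 := by decide
  ext x y
  rw [funMat_apply, h]
  simp only [oneQubit, submatrix_apply, funext_iff, Fin.forall_fin_one]
  generalize x 0 = a
  generalize y 0 = b
  fin_cases a <;> fin_cases b <;> simp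

theorem gateX_mat : gateX.mat = (funMat (ctrlFlip (∅ : Finset (Fin 1)) 0) : QMat 1) :=
  oneQubit_flip

theorem controlled_funMat_ctrlFlip {k : ℕ} (A : Finset (Fin k)) (t : Fin k) :
    controlled (funMat (ctrlFlip A t))
      = funMat (ctrlFlip (insert 0 (A.map (Fin.succEmb k))) t.succ) := by
  ext x y
  rw [funMat_apply]
  unfold controlled
  rw [funMat_apply]
  have htail : x 0 = 1 → Fin.tail (ctrlFlip (insert 0 (A.map (Fin.succEmb k))) t.succ x)
      = ctrlFlip A t (Fin.tail x) := by
    intro h0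
    funext i
    by_cases hi : i = t
    · subst hi
      simp only [Fin.tail, ctrlFlip_apply_self]
      simp only [Finset.forall_mem_insert, h0, true_and, Finset.forall_mem_map, Fin.coe_succEmb]
      congr
    · rw [Fin.tail, ctrlFlip_apply_of_ne _ (by simpa using hi), ctrlFlip_apply_of_ne _ hi, Fin.tail]
  have hzero : ctrlFlip (insert 0 (A.map (Fin.succEmb k))) t.succ x 0 = x 0 :=
    ctrlFlip_apply_of_ne _ (Fin.succ_ne_zero t).symm x
  by_cases h0 : x 0 = 1
  · by_cases h1 : y 0 = 1
    · rw [if_pos ⟨h0, h1⟩, ← htail h0]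
      congr 1
      refine propext ⟨fun h => ?_, fun h => by rw [h]⟩
      rw [← Fin.cons_self_tail y, ← h, h1, ← h0, ← hzero, Fin.cons_self_tail]
    · rw [if_neg (fun h => h1 h.2), if_neg, if_neg]
      · rintro rfl
        exact h1 (hzero.trans h0)
      · rintro rfl
        exact h1 h0
  · have h : ¬ ∀ a ∈ insert 0 (A.map (Fin.succEmb k)), x a = 1 :=
      fun h => h0 (h 0 (Finset.mem_insert_self _ _))
    rw [if_neg (fun h => h0 h.1), ctrlFlip, if_neg h]

theorem gateCX_mat : gateCX.mat = (funMat (ctrlFlip ({0} : Finset (Fin 2)) 1) : QMat 2) := by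
  have h : insert 0 ((∅ : Finset (Fin 1)).map (Fin.succEmb 1)) = {0} := by decide
  change controlled (oneQubit !![0, 1; 1, 0]) = _
  rw [oneQubit_flip, controlled_funMat_ctrlFlip, h]
  rfl

theorem gateCCX_mat : gateCCX.mat = (funMat (ctrlFlip ({0, 1} : Finset (Fin 3)) 2) : QMat 3) := by
  have h : insert 0 (({0} : Finset (Fin 2)).map (Fin.succEmb 2)) = {0, 1} := by decide
  have hX : (gateCX.mat : QMat 2) = funMat (ctrlFlip ({0} : Finset (Fin 2)) 1) := gateCX_mat
  refine (congrArg (controlled (k := 2)) hX).trans ?_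
  rw [controlled_funMat_ctrlFlip, h]
  rfl

theorem ctrlFlip_involutive {n : ℕ} {A : Finset (Fin n)} {t : Fin n} (ht : t ∉ A) :
    Function.Involutive (ctrlFlip A t) := by
  intro x
  have h : (∀ a ∈ A, ctrlFlip A t x a = 1) ↔ ∀ a ∈ A, x a = 1 :=
    forall₂_congr fun a ha => by
      rw [ctrlFlip_apply_of_ne A (ne_of_mem_of_not_mem ha ht)]
  have h2 : ∀ a : Fin 2, a + 1 + 1 = a := by decide
  funext j
  by_cases hj : j = t
  · subst hj
    rw [ctrlFlip_apply_self, ctrlFlip_apply_self]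
    by_cases hA : ∀ a ∈ A, x a = 1
    · rw [if_pos (h.2 hA), if_pos hA, h2]
    · rw [if_neg (mt h.1 hA), if_neg hA]
  · rw [ctrlFlip_apply_of_ne _ hj, ctrlFlip_apply_of_ne _ hj]

/-- A controlled flip with one more control, as a commutator that uses the spare bit `b`. -/
theorem ctrlFlip_insert {n : ℕ} {A : Finset (Fin n)} {b c t : Fin n} (hbA : b ∉ A) (htA : t ∉ A)
    (hbc : b ≠ c) (hbt : b ≠ t) (hct : c ≠ t) :
    ctrlFlip (insert c A) t
      = ctrlFlip A b ∘ ctrlFlip {c, b} t ∘ ctrlFlip A b ∘ ctrlFlip {c, b} t := by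
  funext x j
  have h2 : ∀ a : Fin 2, a + 1 + 1 = a := by decide
  have h3 : ∀ a : Fin 2, a ≠ 1 → a + 1 = 1 := by decide
  -- With `p` the conjunction of the bits in `A`, the target receives `c * b` and then `c * (b +
  -- p)`. Modulo 2 these add up to `c * p`, and the second flip of `b` restores it.
  set x₁ := ctrlFlip {c, b} t x with hx₁
  set x₂ := ctrlFlip A b x₁ with hx₂
  set x₃ := ctrlFlip {c, b} t x₂ with hx₃
  have hA : ∀ y : Bits n, (∀ a ∈ A, y a = x a) → ((∀ a ∈ A, y a = 1) ↔ ∀ a ∈ A, x a = 1) :=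
    fun y hy => forall₂_congr fun a ha => by rw [hy a ha]
  have hA₁ : ∀ a ∈ A, x₁ a = x a := fun a ha =>
    ctrlFlip_apply_of_ne _ (ne_of_mem_of_not_mem ha htA) x
  have hA₂ : ∀ a ∈ A, x₂ a = x a := fun a ha =>
    (ctrlFlip_apply_of_ne _ (ne_of_mem_of_not_mem ha hbA) x₁).trans (hA₁ a ha)
  have hA₃ : ∀ a ∈ A, x₃ a = x a := fun a ha =>
    (ctrlFlip_apply_of_ne _ (ne_of_mem_of_not_mem ha htA) x₂).trans (hA₂ a ha)
  have hb₁ : x₁ b = x b := ctrlFlip_apply_of_ne _ hbt x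
  have hc₁ : x₁ c = x c := ctrlFlip_apply_of_ne _ hct x
  have hc₂ : x₂ c = x c := (ctrlFlip_apply_of_ne _ hbc.symm x₁).trans hc₁
  have hb₂ : x₂ b = if ∀ a ∈ A, x a = 1 then x b + 1 else x b := by
    rw [hx₂, ctrlFlip_apply_self, hb₁]
    simp only [hA x₁ hA₁]
  have hb₃ : x₃ b = x₂ b := ctrlFlip_apply_of_ne _ hbt x₂
  have ht₁ : x₁ t = if x c = 1 ∧ x b = 1 then x t + 1 else x t := by
    rw [hx₁, ctrlFlip_apply_self]; simp
  have ht₂ : x₂ t = x₁ t := ctrlFlip_apply_of_ne _ hbt.symm x₁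
  have ht₃ : x₃ t = if x c = 1 ∧ x₂ b = 1 then x₁ t + 1 else x₁ t := by
    rw [hx₃, ctrlFlip_apply_self, ht₂]; simp [hc₂]
  change _ = ctrlFlip A b x₃ j
  by_cases hjt : j = t
  · subst hjt
    rw [ctrlFlip_apply_of_ne _ hbt.symm, ht₃, hb₂, ht₁, ctrlFlip_apply_self]
    rw [if_congr (Finset.forall_mem_insert ..) rfl rfl]
    by_cases q : x c = 1
    · by_cases p : ∀ a ∈ A, x a = 1
      · rw [if_pos ⟨q, p⟩, if_pos p]
        by_cases r : x b = 1 <;> simp [q, r, h3]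
      · rw [if_neg fun h => p h.2, if_neg p]
        by_cases r : x b = 1 <;> simp [q, r, h2]
    · simp [q]
  · by_cases hjb : j = b
    · subst hjb
      rw [ctrlFlip_apply_of_ne _ hjt, ctrlFlip_apply_self, hb₃, hb₂]
      simp only [hA x₃ hA₃]
      split_ifs <;> simp [h2]
    · rw [ctrlFlip_apply_of_ne _ hjt, ctrlFlip_apply_of_ne _ hjb, hx₃, ctrlFlip_apply_of_ne _ hjt,
        hx₂, ctrlFlip_apply_of_ne _ hjb, hx₁, ctrlFlip_apply_of_ne _ hjt]

/-! ### Circuits as a submonoid; multiply controlled flips -/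

/-- The matrices of the circuits on `n` wires over `{X, CX, CCX, H}`. -/
def circuitMonoid (n : ℕ) : Submonoid (QMat n) where
  carrier := {M | ∃ C : Circuit toffoliHadamard n, C.eval = M}
  one_mem' := ⟨.id, rfl⟩
  mul_mem' := by
    rintro _ _ ⟨C, rfl⟩ ⟨D, rfl⟩
    exact ⟨.comp C D, rfl⟩

theorem onWires_gate_mem {n : ℕ} {g : Gate} (hg : g ∈ toffoliHadamard)
    (e : Fin g.arity ↪ Fin n) : onWires e g.mat ∈ circuitMonoid n :=
  ⟨.gate g hg e, rfl⟩

/-- The single wire `i` of `n` wires. -/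
def wire {n : ℕ} (i : Fin n) : Fin 1 ↪ Fin n :=
  ⟨fun _ => i, Function.injective_of_subsingleton _⟩

/-- The Hadamard gate on the wire `i`. -/
noncomputable def hadamard {n : ℕ} (i : Fin n) : QMat n :=
  onWires (wire i) (oneQubit ((1 / (Real.sqrt 2 : ℂ)) • !![1, 1; 1, -1]))

theorem onWires_hadamard {k n : ℕ} (e : Fin k ↪ Fin n) (i : Fin k) :
    onWires e (hadamard i) = hadamard (e i) :=
  onWires_trans _ _ _

theorem hadamard_mem {n : ℕ} (i : Fin n) : hadamard i ∈ circuitMonoid n :=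
  onWires_gate_mem (g := gateH) (by simp [toffoliHadamard]) (wire i)

theorem flip_mem {n : ℕ} (t : Fin n) : funMat (ctrlFlip ∅ t) ∈ circuitMonoid n := by
  have h := onWires_gate_mem (g := gateX) (by simp [toffoliHadamard]) (wire t)
  rw [gateX_mat] at h
  have h' := onWires_funMat_ctrlFlip (wire t) ∅ 0
  rw [Finset.map_empty] at h'
  exact h' ▸ h

theorem toffoli_mem {n : ℕ} {b c t : Fin n} (hbc : b ≠ c) (hbt : b ≠ t) (hct : c ≠ t) :
    funMat (ctrlFlip {c, b} t) ∈ circuitMonoid n := by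
  let e : Fin 3 ↪ Fin n := ⟨![c, b, t], by
    intro i j
    fin_cases i <;> fin_cases j <;> simp [hbc, hbt, hct, hbc.symm, hbt.symm, hct.symm]⟩
  have h := onWires_gate_mem (g := gateCCX) (by simp [toffoliHadamard]) e
  rw [gateCCX_mat] at h
  have h' := onWires_funMat_ctrlFlip e {0, 1} 2
  rw [Finset.map_insert, Finset.map_singleton] at h'
  exact h' ▸ h

/-- With a spare wire, all multiply controlled flips are circuits. -/
theorem funMat_ctrlFlip_mem {n : ℕ} (A : Finset (Fin n)) :
    ∀ t b : Fin n, t ∉ A → b ∉ A → b ≠ t → funMat (ctrlFlip A t) ∈ circuitMonoid n := by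
  induction A using Finset.induction_on with
  | empty => exact fun t _ _ _ _ => flip_mem t
  | insert c A hc ih =>
    intro t b ht hb hbt
    simp only [Finset.mem_insert, not_or] at ht hb
    -- Target and spare trade roles: the flip of `b` controlled by `A` borrows `t`.
    have h₁ := ih b t hb.2 ht.2 (Ne.symm hbt)
    have h₂ := toffoli_mem hb.1 hbt (Ne.symm ht.1)
    rw [ctrlFlip_insert hb.2 ht.2 hb.1 hbt (Ne.symm ht.1), ← Function.comp_assoc,
      ← Function.comp_assoc, ← funMat_mul_funMat, ← funMat_mul_funMat, ← funMat_mul_funMat]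
    exact mul_mem h₂ (mul_mem h₁ (mul_mem h₂ h₁))

/-! ### The Hadamard gate -/

theorem sqrtTwo_mul_self : (Real.sqrt 2 : ℂ) * (Real.sqrt 2 : ℂ) = 2 := by
  norm_cast
  simp

theorem sqrtTwo_pow_two_mul (k : ℕ) : (Real.sqrt 2 : ℂ) ^ (2 * k) = 2 ^ k := by
  rw [pow_mul, pow_two, sqrtTwo_mul_self]

theorem hadamard_apply_of_ne {n : ℕ} (i : Fin n) {x y : Bits n}
    (h : ¬ ∀ j, j ≠ i → x j = y j) : hadamard i x y = 0 := by
  refine onWires_apply_of_ne _ _ fun H => h fun j hj => H j ?_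
  rintro ⟨l, hl⟩
  exact hj hl.symm

theorem hadamard_apply_of_eq {n : ℕ} (i : Fin n) {x y : Bits n}
    (h : ∀ j, j ≠ i → x j = y j) :
    hadamard i x y = if x i = 1 ∧ y i = 1 then -1 / (Real.sqrt 2 : ℂ)
      else 1 / (Real.sqrt 2 : ℂ) := by
  refine (onWires_apply_of_eq _ _ fun j hj => h j fun hji => hj ⟨0, hji.symm⟩).trans ?_
  simp only [oneQubit, submatrix_apply, Function.comp_apply]
  change (1 / (Real.sqrt 2 : ℂ)) • (!![1, 1; 1, -1] : Matrix (Fin 2) (Fin 2) ℂ) (x i) (y i) = _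
  generalize x i = a
  generalize y i = b
  fin_cases a <;> fin_cases b <;> simp [neg_div]

theorem hadamard_comm_apply {n : ℕ} (i : Fin n) (x y : Bits n) :
    hadamard i x y = hadamard i y x := by
  by_cases h : ∀ j, j ≠ i → x j = y j
  · rw [hadamard_apply_of_eq i h, hadamard_apply_of_eq i fun j hj => (h j hj).symm]
    simp only [and_comm]
  · rw [hadamard_apply_of_ne i h, hadamard_apply_of_ne i]
    exact fun H => h fun j hj => (H j hj).symm

theorem hadamard_transpose {n : ℕ} (i : Fin n) : (hadamard i)ᵀ = hadamard i := by
  ext x y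
  rw [transpose_apply, hadamard_comm_apply]

theorem oneQubit_mul (A B : Matrix (Fin 2) (Fin 2) ℂ) :
    oneQubit A * oneQubit B = oneQubit (A * B) := by
  have h : Function.Bijective fun x : Bits 1 => x 0 :=
    ⟨fun x y hxy => funext fun i => by rw [Subsingleton.elim i 0]; exact hxy,
      fun a => ⟨fun _ => a, rfl⟩⟩
  exact (submatrix_mul A B _ _ _ h).symm

theorem oneQubit_one : oneQubit 1 = 1 := by
  ext x y
  simp only [oneQubit, submatrix_apply, one_apply, funext_iff, Fin.forall_fin_one]

theorem hadamard_mul_self {n : ℕ} (i : Fin n) : hadamard i * hadamard i = 1 := by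
  rw [hadamard, ← onWires_mul, oneQubit_mul]
  have : ((1 / (Real.sqrt 2 : ℂ)) • !![1, 1; 1, -1] * (1 / (Real.sqrt 2 : ℂ)) • !![1, 1; 1, -1]
      : Matrix (Fin 2) (Fin 2) ℂ) = 1 := by
    rw [smul_mul_smul_comm, one_div_mul_one_div, sqrtTwo_mul_self]
    ext a b
    fin_cases a <;> fin_cases b <;> norm_num [Matrix.mul_apply, Fin.sum_univ_two]
  rw [this, oneQubit_one, onWires_one]

theorem isIntMatrixDivSqrtTwoPow_hadamard {n : ℕ} (i : Fin n) :
    IsIntMatrixDivSqrtTwoPow (hadamard i) 1 := by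
  refine IsIntMatrixDivSqrtTwoPow.onWires _
    ⟨(!![1, 1; 1, -1] : Matrix (Fin 2) (Fin 2) ℤ).submatrix (fun x => x 0) (fun y => y 0), ?_⟩
  ext x y
  simp only [oneQubit, submatrix_apply, Matrix.smul_apply, map_apply, pow_one]
  congr 1
  generalize x 0 = a
  generalize y 0 = b
  fin_cases a <;> fin_cases b <;> simp

theorem hadamard_conjTranspose {n : ℕ} (i : Fin n) : (hadamard i)ᴴ = hadamard i := by
  rw [hadamard, onWires_conjTranspose]
  congr 1
  ext x y
  simp only [oneQubit, conjTranspose_apply, submatrix_apply, Matrix.smul_apply]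
  generalize x 0 = a
  generalize y 0 = b
  fin_cases a <;> fin_cases b <;> simp

theorem hadamard_mem_unitaryGroup {n : ℕ} (i : Fin n) :
    hadamard i ∈ unitaryGroup (Bits n) ℂ := by
  rw [mem_unitaryGroup_iff, star_eq_conjTranspose, hadamard_conjTranspose, hadamard_mul_self]

/-! ### Invariants of all circuits: unitarity and integrality -/

theorem funMat_conjTranspose_of_involutive {ι : Type*} [DecidableEq ι] {f : ι → ι}
    (hf : Function.Involutive f) : (funMat f)ᴴ = funMat f := by
  rw [conjTranspose, funMat_transpose_of_involutive hf]
  ext x y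
  rw [map_apply, funMat_apply, apply_ite star, star_one, star_zero]

theorem funMat_mem_unitaryGroup {ι : Type*} [DecidableEq ι] [Fintype ι] {f : ι → ι}
    (hf : Function.Involutive f) : funMat f ∈ unitaryGroup ι ℂ := by
  rw [mem_unitaryGroup_iff, star_eq_conjTranspose, funMat_conjTranspose_of_involutive hf,
    funMat_mul_funMat, hf.comp_self, funMat_id]

theorem onWires_gate_properties {n : ℕ} {g : Gate} (hg : g ∈ toffoliHadamard)
    (e : Fin g.arity ↪ Fin n) : onWires e g.mat ∈ unitaryGroup (Bits n) ℂ ∧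
      ∃ q, IsIntMatrixDivSqrtTwoPow (onWires e g.mat) q := by
  suffices g.mat ∈ unitaryGroup (Bits g.arity) ℂ ∧ ∃ q, IsIntMatrixDivSqrtTwoPow g.mat q from
    ⟨onWires_mem_unitaryGroup e this.1, this.2.imp fun q hq => hq.onWires e⟩
  simp only [toffoliHadamard, Set.mem_insert_iff, Set.mem_singleton_iff] at hg
  rcases hg with rfl | rfl | rfl | rfl
  · rw [gateX_mat]
    exact ⟨funMat_mem_unitaryGroup (ctrlFlip_involutive (Finset.notMem_empty _)), 0,
      isIntMatrixDivSqrtTwoPow_funMat _⟩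
  · rw [gateCX_mat]
    exact ⟨funMat_mem_unitaryGroup (ctrlFlip_involutive (by decide)), 0,
      isIntMatrixDivSqrtTwoPow_funMat _⟩
  · rw [gateCCX_mat]
    exact ⟨funMat_mem_unitaryGroup (ctrlFlip_involutive (by decide)), 0,
      isIntMatrixDivSqrtTwoPow_funMat _⟩
  · have h : hadamard (0 : Fin 1) = gateH.mat := by
      ext x y
      rw [hadamard, onWires_apply_of_eq]
      · have : ∀ x : Bits 1, x ∘ wire 0 = x := fun x => funext fun i => by
          rw [Subsingleton.elim i 0]; rfl
        rw [this, this]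
        rfl
      · exact fun j hj => absurd ⟨0, Subsingleton.elim _ _⟩ hj
    exact h ▸ ⟨hadamard_mem_unitaryGroup (0 : Fin 1), 1,
      isIntMatrixDivSqrtTwoPow_hadamard (0 : Fin 1)⟩

theorem Circuit.eval_properties {n : ℕ} (C : Circuit toffoliHadamard n) :
    C.eval ∈ unitaryGroup (Bits n) ℂ ∧ ∃ q, IsIntMatrixDivSqrtTwoPow C.eval q := by
  induction C with
  | id =>
    refine ⟨one_mem _, 0, ?_⟩
    rw [Circuit.eval, ← funMat_id]
    exact isIntMatrixDivSqrtTwoPow_funMat _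
  | gate g hg e => exact onWires_gate_properties hg e
  | comp C D hC hD =>
    obtain ⟨hC, p, hp⟩ := hC
    obtain ⟨hD, q, hq⟩ := hD
    exact ⟨mul_mem hC hD, p + q, hp.mul hq⟩

/-! ### Reflections and their conjugates -/

/-- The reflection in the hyperplane orthogonal to the real unit vector `u`. -/
def refl {ι : Type*} [DecidableEq ι] (u : ι → ℂ) : Matrix ι ι ℂ :=
  1 - (2 : ℂ) • vecMulVec u u

/-- Half of the indicator function of `s`. -/
noncomputable def halfIndicator {ι : Type*} [DecidableEq ι] (s : Finset ι) : ι → ℂ :=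
  fun x => if x ∈ s then 1 / 2 else 0

section Reflections

variable {ι : Type*} [DecidableEq ι]

theorem refl_apply (u : ι → ℂ) (x y : ι) :
    refl u x y = (if x = y then 1 else 0) - 2 * (u x * u y) := by
  simp [refl, Matrix.one_apply, vecMulVec_apply]

theorem halfIndicator_of_mem {s : Finset ι} {x : ι} (h : x ∈ s) : halfIndicator s x = 1 / 2 :=
  if_pos h

theorem halfIndicator_of_notMem {s : Finset ι} {x : ι} (h : x ∉ s) : halfIndicator s x = 0 :=
  if_neg h

variable [Fintype ι]

theorem refl_mul_apply (u : ι → ℂ) (V : Matrix ι ι ℂ) (l i : ι) :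
    (refl u * V) l i = V l i - 2 * (u l * ∑ x, u x * V x i) := by
  rw [refl, Matrix.sub_mul, Matrix.one_mul, smul_mul_assoc, vecMulVec_mul]
  simp [vecMulVec_apply, vecMul, dotProduct]

theorem refl_mul_self {u : ι → ℂ} (hu : ∑ x, u x * u x = 1) : refl u * refl u = 1 := by
  ext x y
  have h : ∑ z, u z * refl u z y = - u y := by
    simp only [refl_apply, mul_sub, Finset.sum_sub_distrib, mul_ite, mul_one, mul_zero,
      Finset.sum_ite_eq', Finset.mem_univ, if_true]
    have : ∀ z, u z * (2 * (u z * u y)) = u z * u z * (2 * u y) := fun z => by ring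
    simp only [this, ← Finset.sum_mul, hu]
    ring
  rw [refl_mul_apply, h, refl_apply, Matrix.one_apply]
  ring

theorem refl_mem_unitaryGroup {u : ι → ℂ} (hu : ∑ x, u x * u x = 1) (hu' : ∀ x, star (u x) = u x) :
    refl u ∈ unitaryGroup ι ℂ := by
  have h : (refl u)ᴴ = refl u := by
    ext x y
    rw [conjTranspose_apply, refl_apply, refl_apply]
    simp [hu', apply_ite (star : ℂ → ℂ), eq_comm (a := y), mul_comm (u y)]
  rw [mem_unitaryGroup_iff, star_eq_conjTranspose, h, refl_mul_self hu]

/-- Reflections are built from `u uᵀ`, without complex conjugation, so the transpose is what moves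
`u` to `M *ᵥ u`. The matrices used here, permutations and Hadamards, are real. -/
theorem mul_refl_mul_transpose {M : Matrix ι ι ℂ} (hM : M * Mᵀ = 1) (u : ι → ℂ) :
    M * refl u * Mᵀ = refl (M *ᵥ u) := by
  rw [refl, Matrix.mul_sub, Matrix.sub_mul, Matrix.mul_one, hM, mul_smul_comm, smul_mul_assoc,
    mul_vecMulVec, vecMulVec_mul, vecMul_transpose, refl]

theorem refl_mulVec_mem {S : Submonoid (Matrix ι ι ℂ)} {M : Matrix ι ι ℂ} (hM : M ∈ S)
    (hMt : Mᵀ ∈ S) (h : M * Mᵀ = 1) {u : ι → ℂ} (hu : refl u ∈ S) : refl (M *ᵥ u) ∈ S :=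
  mul_refl_mul_transpose h u ▸ mul_mem (mul_mem hM hu) hMt

theorem funMat_mulVec (f : ι → ι) (u : ι → ℂ) : funMat f *ᵥ u = u ∘ f := by
  ext x
  simp [mulVec, dotProduct, funMat_apply]

theorem funMat_perm_transpose (σ : Equiv.Perm ι) : (funMat σ)ᵀ = funMat σ.symm := by
  ext x y
  rw [transpose_apply, funMat_apply, funMat_apply]
  congr 1
  rw [eq_iff_iff, Equiv.symm_apply_eq, eq_comm]

theorem refl_comp_perm_mem {S : Submonoid (Matrix ι ι ℂ)}
    (hS : ∀ σ : Equiv.Perm ι, funMat σ ∈ S) (σ : Equiv.Perm ι) {u : ι → ℂ} (hu : refl u ∈ S) :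
    refl (u ∘ σ) ∈ S := by
  rw [← funMat_mulVec]
  refine refl_mulVec_mem (hS σ) ?_ ?_ hu
  · rw [funMat_perm_transpose]
    exact hS _
  · rw [funMat_perm_transpose, funMat_mul_funMat, Equiv.symm_comp_self, funMat_id]

theorem refl_halfIndicator_mem {S : Submonoid (Matrix ι ι ℂ)}
    (hS : ∀ σ : Equiv.Perm ι, funMat σ ∈ S) {s t : Finset ι} (hst : s.card = t.card)
    (hs : refl (halfIndicator s) ∈ S) : refl (halfIndicator t) ∈ S := by
  let σ : Equiv.Perm ι := (Finset.equivOfCardEq hst.symm).extendSubtype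
  have hσ : ∀ x, σ x ∈ s ↔ x ∈ t := fun x => by
    constructor
    · intro h
      by_contra hx
      exact Equiv.extendSubtype_not_mem (Finset.equivOfCardEq hst.symm) x hx h
    · exact fun hx => Equiv.extendSubtype_mem (Finset.equivOfCardEq hst.symm) x hx
  have : halfIndicator t = halfIndicator s ∘ σ := by
    funext x
    simp only [halfIndicator, Function.comp_apply, hσ]
  rw [this]
  exact refl_comp_perm_mem hS σ hs

theorem refl_single_mem {S : Submonoid (Matrix ι ι ℂ)}
    (hS : ∀ σ : Equiv.Perm ι, funMat σ ∈ S) {a b : ι}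
    (ha : refl (Pi.single a 1) ∈ S) : refl (Pi.single b 1) ∈ S := by
  have : (Pi.single b 1 : ι → ℂ) = Pi.single a 1 ∘ Equiv.swap a b := by
    funext x
    simp only [Pi.single_apply, Function.comp_apply]
    congr 1
    rw [Equiv.swap_apply_eq_iff, Equiv.swap_apply_left]
  rw [this]
  exact refl_comp_perm_mem hS _ ha

end Reflections

/-! ### Generating all permutations of the basis -/

section Permutations

variable {n : ℕ} {S : Submonoid (QMat n)}

/-- The permutations whose matrices lie in `S`. -/
def permSubmonoid {ι : Type*} [DecidableEq ι] [Fintype ι] (S : Submonoid (Matrix ι ι ℂ)) :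
    Submonoid (Equiv.Perm ι) where
  carrier := {σ | funMat σ ∈ S}
  one_mem' := by
    change funMat id ∈ S
    rw [funMat_id]
    exact one_mem S
  mul_mem' := by
    intro σ τ hσ hτ
    change funMat (σ ∘ τ) ∈ S
    rw [← funMat_mul_funMat]
    exact mul_mem hτ hσ

theorem mem_permSubmonoid {ι : Type*} [DecidableEq ι] [Fintype ι] {S : Submonoid (Matrix ι ι ℂ)}
    {σ : Equiv.Perm ι} : σ ∈ permSubmonoid S ↔ funMat σ ∈ S := Iff.rfl

theorem bits_induction {p : AddSubmonoid (Bits n)} (h : ∀ t, Pi.single t 1 ∈ p) (v : Bits n) :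
    v ∈ p := by
  rw [← Finset.univ_sum_single v]
  refine sum_mem fun t _ => ?_
  have : ∀ a : Fin 2, a = 0 ∨ a = 1 := by decide
  rcases this (v t) with h0 | h1
  · rw [h0, Pi.single_zero]
    exact zero_mem p
  · rw [h1]
    exact h t

theorem addRight_mem (hflip : ∀ t, funMat (ctrlFlip ∅ t) ∈ S) (v : Bits n) :
    Equiv.addRight v ∈ permSubmonoid S := by
  let p : AddSubmonoid (Bits n) :=
    { carrier := {v | Equiv.addRight v ∈ permSubmonoid S}
      zero_mem' := by
        change Equiv.addRight (0 : Bits n) ∈ permSubmonoid S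
        rw [Equiv.addRight_zero]
        exact one_mem _
      add_mem' := by
        intro a b ha hb
        change Equiv.addRight (a + b) ∈ permSubmonoid S
        have : Equiv.addRight (a + b) = Equiv.addRight b * Equiv.addRight a :=
          Equiv.ext fun x => (add_assoc x a b).symm
        rw [this]
        exact mul_mem hb ha }
  refine bits_induction (p := p) (fun t => ?_) v
  change funMat (fun x => x + Pi.single t 1) ∈ S
  convert hflip t using 2
  funext x
  simp [ctrlFlip]

/-- Only two strings have all bits other than `t` equal to `1`, so the fully controlled flip is a
transposition. -/
theorem ctrlFlip_erase (t : Fin n) :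
    ctrlFlip (Finset.univ.erase t) t = Equiv.swap (1 : Bits n) (1 + Pi.single t 1) := by
  funext x
  have h11 : (1 : Fin 2) + 1 = 0 := by decide
  have h2 : ∀ a : Fin 2, a ≠ 1 → a = 0 := by decide
  by_cases h : ∀ a ∈ Finset.univ.erase t, x a = 1
  · rw [ctrlFlip, if_pos h]
    by_cases ht : x t = 1
    · have : x = 1 := by
        funext a
        by_cases ha : a = t
        · rw [ha]; exact ht
        · exact h a (by simp [ha])
      rw [this, Equiv.swap_apply_left]
    · have : x = 1 + Pi.single t 1 := by
        funext a
        by_cases ha : a = t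
        · subst ha; simp [h2 _ ht, h11]
        · simp [ha, h a (by simp [ha])]
      rw [this, Equiv.swap_apply_right]
      funext a
      by_cases ha : a = t
      · subst ha; simp [h11]
      · simp [ha]
  · rw [ctrlFlip, if_neg h, Equiv.swap_apply_of_ne_of_ne]
    · rintro rfl
      exact h fun _ _ => rfl
    · rintro rfl
      refine h fun a ha => ?_
      simp [Finset.ne_of_mem_erase ha]

/-- Translations conjugate the transposition of `1` and `1 + Pi.single t 1` to the one along any
edge of the hypercube in direction `t`. Composing along paths gives all transpositions, which
generate the symmetric group. -/
theorem funMat_perm_mem (hflip : ∀ t, funMat (ctrlFlip ∅ t) ∈ S)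
    (hctrl : ∀ t, funMat (ctrlFlip (Finset.univ.erase t) t) ∈ S) (σ : Equiv.Perm (Bits n)) :
    funMat σ ∈ S := by
  have h1 : ∀ (a : Bits n) (t : Fin n), Equiv.swap a (a + Pi.single t 1) ∈ permSubmonoid S := by
    intro a t
    have h : Equiv.swap a (a + Pi.single t 1) = Equiv.addRight (a - 1)
        * Equiv.swap 1 (1 + Pi.single t 1) * Equiv.addRight (-(a - 1)) := by
      rw [show Equiv.addRight (-(a - 1)) = (Equiv.addRight (a - 1))⁻¹ from
          (Equiv.addRight_symm _).symm,
        ← Equiv.swap_apply_apply]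
      congr 1
      · simp
      · simp only [Equiv.coe_addRight]; abel
    rw [h]
    refine mul_mem (mul_mem (addRight_mem hflip _) ?_) (addRight_mem hflip _)
    rw [mem_permSubmonoid, ← ctrlFlip_erase]
    exact hctrl t
  let p : AddSubmonoid (Bits n) :=
    { carrier := {v | ∀ a, Equiv.swap a (a + v) ∈ permSubmonoid S}
      zero_mem' := by
        intro a
        rw [add_zero, Equiv.swap_self]
        exact one_mem _
      add_mem' := by
        intro v w hv hw a
        rw [← add_assoc]
        exact SubmonoidClass.swap_mem_trans _ (hv a) (hw (a + v)) }
  have h2 : ∀ a b : Bits n, Equiv.swap a b ∈ permSubmonoid S := fun a b => by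
    have := bits_induction (p := p) (fun t a => h1 a t) (b - a) a
    rwa [add_sub_cancel] at this
  rw [← mem_permSubmonoid]
  have : permSubmonoid S = ⊤ := by
    rw [eq_top_iff, ← Equiv.Perm.mclosure_isSwap, Submonoid.closure_le]
    rintro _ ⟨a, b, -, rfl⟩
    exact h2 a b
  rw [this]
  trivial

end Permutations

/-! ### Sign changes and four-term reflections from Hadamards -/

section Hadamards

variable {n : ℕ} {S : Submonoid (QMat n)}

/-- The Hadamard sends the basis vector at `1` to a normalised difference of two basis vectors. The
reflection in such a difference swaps the two. -/
theorem refl_hadamard_one (t : Fin n) :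
    refl (hadamard t *ᵥ Pi.single (1 : Bits n) 1) = funMat (Equiv.swap 1 (1 + Pi.single t 1)) := by
  have h11 : (1 : Fin 2) + 1 = 0 := by decide
  have h2 : ∀ a : Fin 2, a ≠ 1 → a = 0 := by decide
  set b : Bits n := 1 + Pi.single t 1 with hb
  have hbt : b t = 0 := by simp [hb, h11]
  have hba : ∀ j, j ≠ t → b j = 1 := fun j hj => by simp [hb, hj]
  have hab : (1 : Bits n) ≠ b := fun h => by simpa [hbt] using congrFun h t
  have hu : ∀ x, (hadamard t *ᵥ Pi.single (1 : Bits n) 1) x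
      = if x = 1 then -1 / (Real.sqrt 2 : ℂ) else if x = b then 1 / (Real.sqrt 2 : ℂ) else 0 := by
    intro x
    rw [mulVec_single_one, Matrix.col_apply]
    by_cases h : ∀ j, j ≠ t → x j = (1 : Bits n) j
    · rw [hadamard_apply_of_eq t h]
      by_cases hx : x t = 1
      · have : x = 1 := funext fun j => by
          by_cases hj : j = t
          · rw [hj, hx]; rfl
          · exact h j hj
        simp [this]
      · have : x = b := funext fun j => by
          by_cases hj : j = t
          · rw [hj, hbt, h2 _ hx]
          · rw [hba j hj, h j hj]; rfl
        simp [this, hbt, hab.symm]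
    · rw [hadamard_apply_of_ne t h, if_neg, if_neg]
      · rintro rfl
        exact h hba
      · rintro rfl
        exact h fun _ _ => rfl
  have hsq : (Real.sqrt 2 : ℂ)⁻¹ * (Real.sqrt 2 : ℂ)⁻¹ = 1 / 2 := by
    rw [← mul_inv, sqrtTwo_mul_self, one_div]
  ext x y
  rw [refl_apply, hu, hu, funMat_apply]
  by_cases hx : x = 1
  · subst hx
    rw [Equiv.swap_apply_left]
    by_cases hy : y = 1
    · subst hy
      simp [neg_div, hab.symm, hsq]
    · by_cases hy' : y = b
      · subst hy'
        simp [neg_div, hab.symm, hsq, hab]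
      · simp [hy, hy', Ne.symm hy, Ne.symm hy']
  · by_cases hx' : x = b
    · rw [hx', Equiv.swap_apply_right]
      by_cases hy : y = 1
      · subst hy
        simp [neg_div, hab.symm, hsq]
      · by_cases hy' : y = b
        · subst hy'
          simp [hab.symm, hsq, hab]
        · simp [hy, hy', Ne.symm hy, Ne.symm hy']
    · rw [Equiv.swap_apply_of_ne_of_ne hx hx']
      simp [hx, hx']

theorem refl_hadamard_mem (hH : ∀ t, hadamard t ∈ S) (t : Fin n) {u : Bits n → ℂ}
    (hu : refl u ∈ S) : refl (hadamard t *ᵥ u) ∈ S :=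
  refl_mulVec_mem (hH t) (by rw [hadamard_transpose]; exact hH t)
    (by rw [hadamard_transpose, hadamard_mul_self]) hu

theorem refl_single_mem_of_hadamard (hH : ∀ t, hadamard t ∈ S)
    (hperm : ∀ σ : Equiv.Perm (Bits n), funMat σ ∈ S) (t : Fin n) (a : Bits n) :
    refl (Pi.single a 1) ∈ S := by
  refine refl_single_mem hperm (a := 1) ?_
  have h := refl_hadamard_mem hH t
    (u := hadamard t *ᵥ Pi.single (1 : Bits n) 1) (by rw [refl_hadamard_one]; exact hperm _)
  rwa [mulVec_mulVec, hadamard_mul_self, one_mulVec] at h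

theorem hadamard_mulVec_dotProduct (t : Fin n) (u : Bits n → ℂ) :
    (hadamard t *ᵥ u) ⬝ᵥ (hadamard t *ᵥ u) = u ⬝ᵥ u := by
  rw [dotProduct_mulVec, ← mulVec_transpose, hadamard_transpose, mulVec_mulVec, hadamard_mul_self,
    one_mulVec]

theorem hadamard_hadamard_zero {i j : Fin n} (hij : i ≠ j) :
    hadamard j *ᵥ (hadamard i *ᵥ Pi.single (0 : Bits n) 1)
      = halfIndicator {x | ∀ l, l ≠ i → l ≠ j → x l = 0} := by
  have hsq : (Real.sqrt 2 : ℂ)⁻¹ * (Real.sqrt 2 : ℂ)⁻¹ = 1 / 2 := by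
    rw [← mul_inv, sqrtTwo_mul_self, one_div]
  funext x
  rw [mulVec_single_one]
  simp only [mulVec, dotProduct, Matrix.col_apply]
  rw [Finset.sum_eq_single (Function.update x j 0)]
  · rw [hadamard_apply_of_eq j fun l hl => (Function.update_of_ne hl _ _).symm]
    by_cases h : ∀ l, l ≠ i → l ≠ j → x l = 0
    · rw [hadamard_apply_of_eq i, halfIndicator_of_mem (by simpa using h)]
      · simp [hsq]
      · intro l hl
        by_cases hlj : l = j
        · subst hlj; simp
        · rw [Function.update_of_ne hlj, h l hl hlj]; rfl
    · rw [hadamard_apply_of_ne i, halfIndicator_of_notMem (by simpa using h), mul_zero]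
      refine fun H => h fun l hl hlj => ?_
      rw [← Function.update_of_ne hlj 0 x, H l hl]; rfl
  · intro y _ hy
    by_cases h : ∀ l, l ≠ j → x l = y l
    · rw [hadamard_apply_of_ne i, mul_zero]
      refine fun H => hy (funext fun l => ?_)
      by_cases hl : l = j
      · subst hl
        rw [Function.update_self, H l hij.symm]; rfl
      · rw [Function.update_of_ne hl, h l hl]
    · rw [hadamard_apply_of_ne j h, zero_mul]
  · simp

theorem halfIndicator_dotProduct_self {ι : Type*} [DecidableEq ι] [Fintype ι] (s : Finset ι) :
    halfIndicator s ⬝ᵥ halfIndicator s = s.card / 4 := by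
  have : ∀ x, halfIndicator s x * halfIndicator s x = if x ∈ s then 1 / 4 else 0 := fun x => by
    by_cases h : x ∈ s
    · rw [halfIndicator_of_mem h, if_pos h]; norm_num
    · rw [halfIndicator_of_notMem h, if_neg h, zero_mul]
  simp only [dotProduct, this]
  rw [← Finset.sum_filter, Finset.filter_mem_eq_inter, Finset.univ_inter, Finset.sum_const,
    nsmul_eq_mul, mul_one_div]

theorem refl_halfIndicator_mem_of_hadamard (hH : ∀ t, hadamard t ∈ S)
    (hperm : ∀ σ : Equiv.Perm (Bits n), funMat σ ∈ S) {s : Finset (Bits n)} (hs : s.card = 4) :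
    refl (halfIndicator s) ∈ S := by
  have hn : 1 < n := by
    have h := Finset.card_le_univ s
    rw [hs] at h
    by_contra hn
    have : Fintype.card (Bits n) ≤ 2 := by
      interval_cases n <;> simp
    omega
  let i : Fin n := ⟨0, by omega⟩
  let j : Fin n := ⟨1, hn⟩
  have hij : i ≠ j := by simp [i, j]
  have h := refl_hadamard_mem hH j (refl_hadamard_mem hH i
    (refl_single_mem_of_hadamard hH hperm i 0))
  -- The support of the vector has four elements because Hadamards preserve the norm: `card / 4 =
  -- 1`. No counting is needed.
  have hcard := hadamard_mulVec_dotProduct j (hadamard i *ᵥ Pi.single (0 : Bits n) 1)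
  rw [hadamard_hadamard_zero hij, hadamard_mulVec_dotProduct,
    halfIndicator_dotProduct_self] at hcard
  rw [hadamard_hadamard_zero hij] at h
  refine refl_halfIndicator_mem hperm (hs.symm ▸ ?_) h
  rw [single_dotProduct, Pi.single_eq_same, mul_one, div_eq_one_iff_eq (by norm_num)] at hcard
  exact_mod_cast hcard

end Hadamards

/-! ### Column reduction of dyadic unitary matrices -/

section Reduction

variable {ι : Type*} [DecidableEq ι] [Fintype ι]

/-- Unitary matrices of the form `W / 2 ^ k` with `W` an integer matrix. -/
def dyadicUnitary (ι : Type*) [DecidableEq ι] [Fintype ι] : Submonoid (Matrix ι ι ℂ) where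
  carrier := {V | V ∈ unitaryGroup ι ℂ ∧ ∃ k, IsIntMatrixDivSqrtTwoPow V (2 * k)}
  one_mem' := ⟨one_mem _, 0, by rw [← funMat_id]; exact isIntMatrixDivSqrtTwoPow_funMat _⟩
  mul_mem' := by
    rintro U V ⟨hU, k, hk⟩ ⟨hV, l, hl⟩
    exact ⟨mul_mem hU hV, k + l, by rw [mul_add]; exact hk.mul hl⟩

theorem sum_sq_pi_single (a : ι) :
    ∑ x, (Pi.single a 1 : ι → ℂ) x * (Pi.single a 1 : ι → ℂ) x = 1 := by
  simp [Pi.single_apply]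

theorem sum_sq_halfIndicator {s : Finset ι} (hs : s.card = 4) :
    ∑ x, halfIndicator s x * halfIndicator s x = 1 := by
  have := halfIndicator_dotProduct_self s
  rw [hs] at this
  rw [← dotProduct, this]
  norm_num

theorem refl_single_mem_dyadicUnitary (a : ι) : refl (Pi.single a 1) ∈ dyadicUnitary ι := by
  refine ⟨refl_mem_unitaryGroup (sum_sq_pi_single a) fun x => ?_, 0,
    Matrix.of fun x y => (if x = y then 1 else 0) -
      2 * ((Pi.single a 1 : ι → ℤ) x * (Pi.single a 1 : ι → ℤ) y), ?_⟩
  · simp [Pi.single_apply, apply_ite (star : ℂ → ℂ)]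
  · ext x y
    rw [refl_apply]
    simp [Pi.single_apply]

theorem refl_halfIndicator_mem_dyadicUnitary {s : Finset ι} (hs : s.card = 4) :
    refl (halfIndicator s) ∈ dyadicUnitary ι := by
  refine ⟨refl_mem_unitaryGroup (sum_sq_halfIndicator hs) fun x => ?_, 1,
    Matrix.of fun x y => (if x = y then 2 else 0) - if x ∈ s ∧ y ∈ s then 1 else 0, ?_⟩
  · simp [halfIndicator, apply_ite (star : ℂ → ℂ)]
  · ext x y
    rw [refl_apply, Matrix.smul_apply, sqrtTwo_pow_two_mul, map_apply, of_apply]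
    by_cases hxy : x = y <;> by_cases hx : x ∈ s <;> by_cases hy : y ∈ s <;>
      simp [halfIndicator, hxy, hx, hy] <;> norm_num

theorem funMat_swap_mem_dyadicUnitary (i j : ι) : funMat (Equiv.swap i j) ∈ dyadicUnitary ι :=
  ⟨funMat_mem_unitaryGroup (Equiv.swap_apply_self i j), 0, isIntMatrixDivSqrtTwoPow_funMat _⟩

theorem mem_of_mul_mem {S : Submonoid (Matrix ι ι ℂ)} {g V : Matrix ι ι ℂ} (hg : g ∈ S)
    (hgg : g * g = 1) (h : g * V ∈ S) : V ∈ S := by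
  have := mul_mem hg h
  rwa [← mul_assoc, hgg, one_mul] at this

/-- The columns of `V` with index in `F` are those of the identity matrix. -/
def FixesOn (V : Matrix ι ι ℂ) (F : Finset ι) : Prop :=
  ∀ j ∈ F, ∀ l, V l j = (1 : Matrix ι ι ℂ) l j

theorem FixesOn.refl_mul {V : Matrix ι ι ℂ} {F : Finset ι} (hV : FixesOn V F) {u : ι → ℂ}
    (hu : ∀ j ∈ F, u j = 0) : FixesOn (refl u * V) F := by
  intro j hj l
  rw [refl_mul_apply, hV j hj]
  have : ∑ x, u x * V x j = u j := by
    simp [hV j hj, Matrix.one_apply]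
  rw [this, hu j hj, mul_zero, mul_zero, sub_zero]

theorem FixesOn.funMat_swap_mul {V : Matrix ι ι ℂ} {F : Finset ι} (hV : FixesOn V F) {a b : ι}
    (ha : a ∉ F) (hb : b ∉ F) : FixesOn (funMat (Equiv.swap a b) * V) F := by
  intro j hj l
  rw [funMat_mul, submatrix_apply, id, hV j hj, Matrix.one_apply, Matrix.one_apply]
  congr 1
  rw [eq_iff_iff, Equiv.swap_apply_eq_iff, Equiv.swap_apply_of_ne_of_ne (ne_of_mem_of_not_mem hj ha)
      (ne_of_mem_of_not_mem hj hb)]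

/-- Column `i` is orthogonal to column `j`, which is a basis vector. Hence later steps touch only
rows outside `F` and do not disturb finished columns. -/
theorem FixesOn.apply_eq_zero {V : Matrix ι ι ℂ} {F : Finset ι} (hV : FixesOn V F)
    (hU : V ∈ unitaryGroup ι ℂ) {i j : ι} (hi : i ∉ F) (hj : j ∈ F) : V j i = 0 := by
  have h := congrFun (congrFun (mem_unitaryGroup_iff'.1 hU) j) i
  rw [Matrix.mul_apply, Matrix.one_apply_ne (ne_of_mem_of_not_mem hj hi)] at h
  simpa [star_apply, hV j hj, Matrix.one_apply, apply_ite (star : ℂ → ℂ)] using h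

theorem sum_sq_eq_of_unitary {V : Matrix ι ι ℂ} (hU : V ∈ unitaryGroup ι ℂ) {i : ι} {k : ℕ}
    {w : ι → ℤ} (hw : ∀ l, V l i = w l / 2 ^ k) : ∑ l, w l ^ 2 = 4 ^ k := by
  have h := congrFun (congrFun (mem_unitaryGroup_iff'.1 hU) i) i
  rw [Matrix.mul_apply, Matrix.one_apply_eq] at h
  have h' : ∀ l, star V i l * V l i = (w l : ℂ) ^ 2 / 4 ^ k := fun l => by
    rw [star_apply, hw, star_div₀, star_pow, star_ofNat, star_intCast, div_mul_div_comm,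
      ← mul_pow, ← pow_two]
    norm_num
  simp only [h', ← Finset.sum_div] at h
  rw [div_eq_one_iff_eq (pow_ne_zero _ (by norm_num))] at h
  exact_mod_cast h

theorem int_sq_zmod_four (a : ℤ) : ((a ^ 2 : ℤ) : ZMod 4) = if Odd a then 1 else 0 := by
  rcases Int.even_or_odd a with h | h
  · rw [if_neg (Int.not_odd_iff_even.2 h)]
    obtain ⟨b, rfl⟩ := h
    rw [ZMod.intCast_zmod_eq_zero_iff_dvd]
    exact ⟨b ^ 2, by push_cast; ring⟩
  · rw [if_pos h]
    obtain ⟨b, rfl⟩ := h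
    have h4 : (4 : ZMod 4) = 0 := by decide
    rw [show (2 * b + 1) ^ 2 = 4 * (b ^ 2 + b) + 1 by ring, Int.cast_add, Int.cast_mul,
      Int.cast_ofNat, h4, zero_mul, zero_add, Int.cast_one]

/-- Modulo 4 an odd square is 1 and an even one is 0, so the sum of squares counts the odd entries.
-/
theorem four_dvd_card_odd {w : ι → ℤ} {k : ℕ} (h : ∑ l, w l ^ 2 = 4 ^ (k + 1)) :
    4 ∣ (Finset.univ.filter fun l => Odd (w l)).card := by
  rw [← ZMod.natCast_eq_zero_iff]
  have h' := congrArg (Int.cast : ℤ → ZMod 4) h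
  rw [Int.cast_sum] at h'
  simp only [int_sq_zmod_four] at h'
  rw [Finset.sum_boole, pow_succ] at h'
  rw [h', Int.cast_mul]
  exact mul_eq_zero_of_right _ (by decide)

theorem eq_single_of_sum_sq_eq_one {w : ι → ℤ} (h : ∑ l, w l ^ 2 = 1) :
    ∃ j, (w j = 1 ∨ w j = -1) ∧ ∀ l, l ≠ j → w l = 0 := by
  obtain ⟨j, hj⟩ : ∃ j, w j ≠ 0 := by
    by_contra! H
    simp [H] at h
  have hs := Finset.add_sum_erase Finset.univ (fun l => w l ^ 2) (Finset.mem_univ j)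
  have hnn : ∀ l ∈ Finset.univ.erase j, 0 ≤ w l ^ 2 := fun l _ => sq_nonneg _
  have h0 := Finset.sum_nonneg hnn
  have hj1 : 0 < w j ^ 2 := by positivity
  simp only [h] at hs
  refine ⟨j, mul_self_eq_one_iff.1 (by rw [← pow_two]; omega), fun l hl => ?_⟩
  have := (Finset.sum_eq_zero_iff_of_nonneg hnn).1 (by omega) l (by simp [hl])
  exact pow_eq_zero_iff (two_ne_zero) |>.1 this

/-- `S` contains the permutation matrices, the sign changes of a basis vector and the reflections
in half the sum of four basis vectors. These generate `dyadicUnitary`. -/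
structure ContainsGenerators (S : Submonoid (Matrix ι ι ℂ)) : Prop where
  perm : ∀ σ : Equiv.Perm ι, funMat σ ∈ S
  sign : ∀ a, refl (Pi.single a 1) ∈ S
  half : ∀ s : Finset ι, s.card = 4 → refl (halfIndicator s) ∈ S

variable {S : Submonoid (Matrix ι ι ℂ)}

theorem sum_single_mul (a : ι) (V : Matrix ι ι ℂ) (i : ι) :
    ∑ x, (Pi.single a 1 : ι → ℂ) x * V x i = V a i := by
  simp [Pi.single_apply]

theorem refl_single_mul_apply (a : ι) (V : Matrix ι ι ℂ) (l i : ι) :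
    (refl (Pi.single a 1) * V) l i = if l = a then - V l i else V l i := by
  rw [refl_mul_apply, sum_single_mul, Pi.single_apply]
  split_ifs with h
  · rw [h]; ring
  · ring

theorem mem_of_column_signed_single (hS : ContainsGenerators S) {F : Finset ι} {i : ι}
    (hi : i ∉ F)
    (ih : ∀ V ∈ dyadicUnitary ι, FixesOn V (insert i F) → V ∈ S) {V : Matrix ι ι ℂ}
    (hV : V ∈ dyadicUnitary ι) (hF : FixesOn V F) {w : ι → ℤ} (hw : ∀ l, V l i = w l)
    {j : ι} (hj : w j = 1 ∨ w j = -1) (hj' : ∀ l, l ≠ j → w l = 0) : V ∈ S := by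
  have hjF : j ∉ F := fun h => by
    have := hF.apply_eq_zero hV.1 hi h
    rw [hw] at this
    rcases hj with hj | hj <;> simp [hj] at this
  have hswap : funMat (Equiv.swap i j) * funMat (Equiv.swap i j) = (1 : Matrix ι ι ℂ) := by
    have h : Function.Involutive (Equiv.swap i j) := Equiv.swap_apply_self i j
    rw [funMat_mul_funMat, h.comp_self, funMat_id]
  refine mem_of_mul_mem (hS.perm _) hswap ?_
  have hcol : ∀ l, (funMat (Equiv.swap i j) * V) l i = if l = i then (w j : ℂ) else 0 := by
    intro l
    rw [funMat_mul, submatrix_apply, id, hw]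
    split_ifs with h
    · rw [h, Equiv.swap_apply_left]
    · rw [hj', Int.cast_zero]
      rwa [ne_eq, Equiv.swap_apply_eq_iff, Equiv.swap_apply_right]
  have hD := mul_mem (funMat_swap_mem_dyadicUnitary i j) hV
  have hF' := hF.funMat_swap_mul hi hjF
  generalize funMat (Equiv.swap i j) * V = U at *
  rcases hj with hj | hj
  · refine ih U hD fun m hm l => ?_
    rcases Finset.mem_insert.1 hm with rfl | hm
    · rw [hcol, hj, Matrix.one_apply, Int.cast_one]
    · exact hF' m hm l
  · refine mem_of_mul_mem (hS.sign i) (refl_mul_self (sum_sq_pi_single i)) ?_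
    refine ih _ (mul_mem (refl_single_mem_dyadicUnitary i) hD) fun m hm l => ?_
    rcases Finset.mem_insert.1 hm with rfl | hm
    · rw [refl_single_mul_apply, hcol, hj, Matrix.one_apply]
      split_ifs <;> simp
    · exact hF'.refl_mul (fun x hx => Pi.single_eq_of_ne (ne_of_mem_of_not_mem hx hi) _) m hm l

/-- The reflection subtracts from each entry on `s` half the sum of the entries on `s`, which is
`m`. -/
theorem refl_halfIndicator_mul_apply {V : Matrix ι ι ℂ} {i : ι} {k : ℕ} {w : ι → ℤ}
    (hw : ∀ l, V l i = w l / 2 ^ k) {s : Finset ι} {m : ℤ} (hm : ∑ l ∈ s, w l = 2 * m) (l : ι) :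
    (refl (halfIndicator s) * V) l i = ((if l ∈ s then w l - m else w l : ℤ) : ℂ) / 2 ^ k := by
  have h : ∑ x, halfIndicator s x * V x i = m / 2 ^ k := by
    simp only [halfIndicator, hw, ite_mul, zero_mul]
    rw [← Finset.sum_filter, Finset.filter_mem_eq_inter, Finset.univ_inter, ← Finset.mul_sum,
      ← Finset.sum_div, ← Int.cast_sum, hm]
    push_cast
    ring
  rw [refl_mul_apply, h, hw]
  by_cases hl : l ∈ s
  · rw [halfIndicator_of_mem hl, if_pos hl]
    push_cast
    ring
  · rw [halfIndicator_of_notMem hl, if_neg hl]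
    ring

/-- Changing the sign of one odd entry shifts the half-sum by that odd number, so exactly one of the
two signs makes the half-sum odd. -/
theorem exists_sum_eq_two_mul_odd {w : ι → ℤ} {s : Finset ι} (hs : s.card = 4)
    (hodd : ∀ l ∈ s, Odd (w l)) {a : ι} (ha : a ∈ s) :
    ∃ ε : ℤ, (ε = 1 ∨ ε = -1) ∧ ∃ m, Odd m ∧ ∑ l ∈ s, (if l = a then ε * w l else w l) = 2 * m := by
  have hε : ∀ ε : ℤ, ∑ l ∈ s, (if l = a then ε * w l else w l)
      = ε * w a + ∑ l ∈ s.erase a, w l := fun ε => by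
    rw [← Finset.add_sum_erase _ _ ha, if_pos rfl]
    congr 1
    exact Finset.sum_congr rfl fun l hl => if_neg (Finset.ne_of_mem_erase hl)
  obtain ⟨p, hp⟩ := hodd a ha
  have hrest : Odd (∑ l ∈ s.erase a, w l) := by
    have hc : (s.erase a).card = 3 := by rw [Finset.card_erase_of_mem ha, hs]
    have hodd' : ∀ l ∈ s.erase a, Odd (w l) := fun l hl => hodd l (Finset.mem_of_mem_erase hl)
    obtain ⟨b, c, d, hbc, hbd, hcd, hbcd⟩ := Finset.card_eq_three.1 hc
    rw [hbcd] at hodd' ⊢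
    rw [Finset.sum_insert (by simp [hbc, hbd]), Finset.sum_pair hcd]
    exact (hodd' b (by simp)).add_even ((hodd' c (by simp)).add_odd (hodd' d (by simp)))
  obtain ⟨q, hq⟩ := hrest
  rcases Int.even_or_odd (p + q) with h | h
  · exact ⟨1, Or.inl rfl, p + q + 1, h.add_one, by rw [hε, hp, hq]; ring⟩
  · refine ⟨-1, Or.inr rfl, q - p, ?_, by rw [hε, hp, hq]; ring⟩
    have : q - p = p + q - 2 * p := by ring
    rw [this]
    exact h.sub_even (even_two_mul p)

/-- Outer induction on the exponent `k` of the denominator, inner strong induction on the number `N`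
of odd numerators in column `i`. -/
theorem mem_of_fixesOn_step (hS : ContainsGenerators S) {F : Finset ι} {i : ι} (hi : i ∉ F)
    (ih : ∀ V ∈ dyadicUnitary ι, FixesOn V (insert i F) → V ∈ S) (k : ℕ) :
    ∀ (N : ℕ) (V : Matrix ι ι ℂ) (w : ι → ℤ), V ∈ dyadicUnitary ι → FixesOn V F →
      (∀ l, V l i = w l / 2 ^ k) → (Finset.univ.filter fun l => Odd (w l)).card = N → V ∈ S := by
  induction k with
  | zero =>
    intro N V w hV hF hw _
    have hs := sum_sq_eq_of_unitary hV.1 hw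
    rw [pow_zero] at hs
    obtain ⟨j, hj, hj'⟩ := eq_single_of_sum_sq_eq_one hs
    refine mem_of_column_signed_single hS hi ih hV hF (fun l => ?_) hj hj'
    rw [hw, pow_zero, div_one]
  | succ k ihk =>
    intro N
    induction N using Nat.strong_induction_on with
    | _ N ihN =>
    intro V w hV hF hw hN
    rcases Nat.eq_zero_or_pos N with h0 | hpos
    · rw [h0, Finset.card_eq_zero, Finset.filter_eq_empty_iff] at hN
      have heven : ∀ l, ∃ v, w l = 2 * v := fun l =>
        (even_iff_exists_two_mul.1 (Int.not_odd_iff_even.1 (hN (Finset.mem_univ l))))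
      choose v hv using heven
      refine ihk _ V v hV hF (fun l => ?_) rfl
      rw [hw, hv, Int.cast_mul, pow_succ', Int.cast_ofNat, mul_div_mul_left _ _ two_ne_zero]
    · have h4 := four_dvd_card_odd (sum_sq_eq_of_unitary hV.1 hw)
      obtain ⟨s, hsub, hs⟩ := Finset.exists_subset_card_eq
        (Nat.le_of_dvd (hN ▸ hpos) h4)
      have hodd : ∀ l ∈ s, Odd (w l) := fun l hl => (Finset.mem_filter.1 (hsub hl)).2
      obtain ⟨a, ha⟩ : s.Nonempty := Finset.card_pos.1 (by omega)
      have hsF : ∀ l ∈ F, l ∉ s := fun l hlF hls => by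
        have h := hF.apply_eq_zero hV.1 hi hlF
        rw [hw, div_eq_zero_iff, Int.cast_eq_zero] at h
        have := hodd l hls
        rcases h with h | h
        · rw [h] at this
          exact absurd this (by decide)
        · exact absurd h (pow_ne_zero _ two_ne_zero)
      obtain ⟨ε, hε, m, hm, hsum⟩ := exists_sum_eq_two_mul_odd hs hodd ha
      set w' : ι → ℤ := fun l => if l = a then ε * w l else w l with hw'
      have hoddε : ∀ l, Odd (w' l) ↔ Odd (w l) := fun l => by
        simp only [hw']
        split_ifs
        · rcases hε with rfl | rfl <;> simp
        · rfl
      suffices H : ∀ U ∈ dyadicUnitary ι, FixesOn U F → (∀ l, U l i = w' l / 2 ^ (k + 1)) →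
          U ∈ S by
        rcases hε with rfl | rfl
        · refine H V hV hF fun l => ?_
          simp [hw, hw']
        · refine mem_of_mul_mem (hS.sign a) (refl_mul_self (sum_sq_pi_single a)) ?_
          refine H _ (mul_mem (refl_single_mem_dyadicUnitary a) hV)
            (hF.refl_mul fun x hx =>
              Pi.single_eq_of_ne (ne_of_mem_of_not_mem hx fun h => hsF a h ha) _) fun l => ?_
          rw [refl_single_mul_apply, hw]
          simp only [hw']
          split_ifs <;> simp [neg_div]
      intro U hU hUF hUw
      refine mem_of_mul_mem (hS.half s hs) (refl_mul_self (sum_sq_halfIndicator hs)) ?_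
      refine ihN _ ?_ _ _ (mul_mem (refl_halfIndicator_mem_dyadicUnitary hs) hU)
        (hUF.refl_mul fun x hx => halfIndicator_of_notMem (hsF x hx))
        (refl_halfIndicator_mul_apply hUw hsum) rfl
      rw [← hN]
      -- On `s` an odd entry loses the odd number `m` and becomes even; parities elsewhere are
      -- unchanged. So the odd set shrinks, losing at least `a`.
      refine Finset.card_lt_card ⟨fun l hl => ?_, fun hsub' => ?_⟩
      · rw [Finset.mem_filter] at hl ⊢
        refine ⟨hl.1, ?_⟩
        by_cases hls : l ∈ s
        · exact hodd l hls
        · have := hl.2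
          rwa [if_neg hls, hoddε] at this
      · have := (Finset.mem_filter.1 (hsub' (hsub ha))).2
        rw [if_pos ha] at this
        exact Int.not_even_iff_odd.2 this (((hoddε a).2 (hodd a ha)).sub_odd hm)

theorem mem_of_mem_dyadicUnitary (hS : ContainsGenerators S) {V : Matrix ι ι ℂ}
    (hV : V ∈ dyadicUnitary ι) : V ∈ S := by
  suffices H : ∀ (N : ℕ) (F : Finset ι), Fᶜ.card = N → ∀ V ∈ dyadicUnitary ι, FixesOn V F → V ∈ S
    from H _ ∅ rfl V hV fun j hj => absurd hj (Finset.notMem_empty j)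
  intro N
  induction N with
  | zero =>
    intro F hF V _ hFV
    rw [Finset.card_eq_zero, Finset.compl_eq_empty_iff] at hF
    have : V = 1 := by
      ext l j
      exact hFV j (hF ▸ Finset.mem_univ j) l
    exact this ▸ one_mem S
  | succ N ih =>
    intro F hF V hV hFV
    obtain ⟨i, hi⟩ : Fᶜ.Nonempty := Finset.card_pos.1 (by omega)
    obtain ⟨k, W, hW⟩ := hV.2
    refine mem_of_fixesOn_step hS (Finset.mem_compl.1 hi) (ih _ ?_) k _ V (fun l => W l i) hV hFV
      (fun l => ?_) rfl
    · rw [Finset.compl_insert, Finset.card_erase_of_mem hi, hF]; rfl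
    · rw [hW, Matrix.smul_apply, map_apply, sqrtTwo_pow_two_mul, smul_eq_mul, one_div_mul_eq_div]

end Reduction

/-! ### From the gates to all matrices, with one ancilla -/

section Generation

variable {n : ℕ} {S : Submonoid (QMat n)}

theorem containsGenerators_of_hadamard (t : Fin n) (hH : ∀ t, hadamard t ∈ S)
    (hflip : ∀ t, funMat (ctrlFlip ∅ t) ∈ S)
    (hctrl : ∀ t, funMat (ctrlFlip (Finset.univ.erase t) t) ∈ S) : ContainsGenerators S where
  perm := funMat_perm_mem hflip hctrl
  sign := refl_single_mem_of_hadamard hH (funMat_perm_mem hflip hctrl) t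
  half _ := refl_halfIndicator_mem_of_hadamard hH (funMat_perm_mem hflip hctrl)

theorem mem_of_isIntMatrixDivSqrtTwoPow (t : Fin n) (hH : ∀ t, hadamard t ∈ S)
    (hflip : ∀ t, funMat (ctrlFlip ∅ t) ∈ S)
    (hctrl : ∀ t, funMat (ctrlFlip (Finset.univ.erase t) t) ∈ S) {V : QMat n}
    (hV : V ∈ unitaryGroup (Bits n) ℂ) {q : ℕ} (hq : IsIntMatrixDivSqrtTwoPow V q) : V ∈ S := by
  have hS := containsGenerators_of_hadamard t hH hflip hctrl
  rcases Nat.even_or_odd' q with ⟨k, rfl | rfl⟩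
  · exact mem_of_mem_dyadicUnitary hS ⟨hV, k, hq⟩
  · refine mem_of_mul_mem (hH t) (hadamard_mul_self t) (mem_of_mem_dyadicUnitary hS
      ⟨mul_mem (hadamard_mem_unitaryGroup t) hV, k + 1, ?_⟩)
    rw [show 2 * (k + 1) = 1 + (2 * k + 1) by ring]
    exact (isIntMatrixDivSqrtTwoPow_hadamard t).mul hq

/-- The matrices whose placement on the wires in the range of `e` is a circuit. -/
def wiresMonoid {n m : ℕ} (e : Fin n ↪ Fin m) : Submonoid (QMat n) where
  carrier := {V | onWires e V ∈ circuitMonoid m}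
  one_mem' := by
    change onWires e 1 ∈ circuitMonoid m
    rw [onWires_one]
    exact one_mem _
  mul_mem' := by
    intro U V hU hV
    change onWires e (U * V) ∈ circuitMonoid m
    rw [onWires_mul]
    exact mul_mem hU hV

theorem onWires_mem_circuitMonoid {V : QMat n} (hV : V ∈ unitaryGroup (Bits n) ℂ) {q : ℕ}
    (hq : IsIntMatrixDivSqrtTwoPow V q) : onWires (Fin.castAddEmb 1) V ∈ circuitMonoid (n + 1) := by
  rcases Nat.eq_zero_or_pos n with rfl | hn
  -- Without data wires there is no Hadamard to conjugate by, yet the scalar `-1` must be produced.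
  -- The argument therefore runs on the ancilla wire, where a fully controlled flip has no controls
  -- and needs no spare.
  · refine mem_of_isIntMatrixDivSqrtTwoPow (S := circuitMonoid 1) 0 hadamard_mem flip_mem
      (fun t => ?_) (onWires_mem_unitaryGroup (Fin.castAddEmb 1) hV) (hq.onWires (Fin.castAddEmb 1))
    have : (Finset.univ.erase t) = ∅ := by
      ext a
      simp [Subsingleton.elim a t]
    rw [this]
    exact flip_mem t
  · refine mem_of_isIntMatrixDivSqrtTwoPow (S := wiresMonoid (Fin.castAddEmb 1)) ⟨0, hn⟩
      (fun t => ?_) (fun t => ?_) (fun t => ?_) hV hq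
    · change onWires _ _ ∈ circuitMonoid (n + 1)
      rw [onWires_hadamard]
      exact hadamard_mem _
    · change onWires _ _ ∈ circuitMonoid (n + 1)
      rw [onWires_funMat_ctrlFlip, Finset.map_empty]
      exact flip_mem _
    · change onWires _ _ ∈ circuitMonoid (n + 1)
      rw [onWires_funMat_ctrlFlip]
      have hlast : ∀ i : Fin n, Fin.castAddEmb 1 i ≠ Fin.last n := fun i =>
        (Fin.castSucc_lt_last i).ne
      refine funMat_ctrlFlip_mem _ _ (Fin.last n) ?_ ?_ (hlast t).symm
      · simp
      · intro h
        obtain ⟨i, -, hi⟩ := Finset.mem_map.1 h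
        exact hlast i hi

end Generation

/-! ### Clean ancillas -/

section Ancillas

variable {n m : ℕ}

theorem append_castAdd_natAdd (z : Bits (n + m)) :
    Fin.append (fun i => z (Fin.castAdd m i)) (fun j => z (Fin.natAdd n j)) = z :=
  Fin.append_castAdd_natAdd

theorem append_injective_left (v : Bits m) :
    Function.Injective fun u : Bits n => (Fin.append u v : Bits (n + m)) := by
  intro u u' h
  funext i
  have := congrFun h (Fin.castAdd m i)
  simpa only [Fin.append_left] using this

theorem onWires_castAdd_mulVec_tensorVec (V : QMat n) (ψ : QVec n) (φ : QVec m) :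
    (onWires (Fin.castAddEmb m) V).mulVec (tensorVec ψ φ) = tensorVec (V.mulVec ψ) φ := by
  funext z
  have hnat : ∀ j : Fin m, Fin.natAdd n j ∉ Set.range (Fin.castAddEmb m : Fin n ↪ Fin (n + m)) := by
    rintro j ⟨i, hi⟩
    have := congrArg Fin.val hi
    simp at this
    omega
  simp only [mulVec, dotProduct, tensorVec]
  rw [Finset.sum_mul]
  symm
  refine Finset.sum_of_injOn
    (fun u => (Fin.append u (fun j => z (Fin.natAdd n j)) : Bits (n + m))) ?_ (by simp) ?_ ?_
  · intro u _ v _ huv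
    exact append_injective_left _ huv
  · intro y _ hy
    rw [onWires_apply_of_ne, zero_mul]
    refine fun h => hy ⟨fun i => y (Fin.castAdd m i), by simp, ?_⟩
    rw [← append_castAdd_natAdd y]
    simp only [Fin.append_left]
    congr 1
    funext j
    exact h _ (hnat j)
  · intro u _
    rw [onWires_apply_of_eq]
    · have : (Fin.append u (fun j => z (Fin.natAdd n j)) : Bits (n + m)) ∘ Fin.castAddEmb m = u :=
        funext fun i => Fin.append_left _ _ i
      rw [this]
      simp only [Fin.append_left, Fin.append_right]
      rw [mul_assoc]
      rfl
    · intro j hj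
      induction j using Fin.addCases with
      | left i => exact absurd ⟨i, rfl⟩ hj
      | right i => rw [Fin.append_right]

theorem representableWith_one {V : QMat n} (hV : V ∈ unitaryGroup (Bits n) ℂ) {q : ℕ}
    (hq : IsIntMatrixDivSqrtTwoPow V q) : RepresentableWith toffoliHadamard 1 V := by
  obtain ⟨D, hD⟩ := onWires_mem_circuitMonoid hV hq
  refine ⟨D, fun ψ => ?_⟩
  rw [hD, onWires_castAdd_mulVec_tensorVec]

theorem tensorVec_single_ketZero (y : Bits n) :
    tensorVec (Pi.single y 1) (ketZero m) = Pi.single (Fin.append y 0 : Bits (n + m)) 1 := by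
  funext z
  rw [tensorVec, ketZero, Pi.single_apply, Pi.single_apply, Pi.single_apply]
  have : z = Fin.append y 0 ↔ (fun i => z (Fin.castAdd m i)) = y ∧
      (fun j => z (Fin.natAdd n j)) = 0 := by
    constructor
    · rintro rfl
      exact ⟨funext fun i => Fin.append_left _ _ i, funext fun j => Fin.append_right _ _ j⟩
    · rintro ⟨h₁, h₂⟩
      rw [← h₁, ← h₂, append_castAdd_natAdd]
  simp only [this, ite_and]
  split_ifs <;> simp

theorem Represents.eval_apply {D : Circuit toffoliHadamard (n + m)} {V : QMat n}
    (h : Represents D V) (z : Bits (n + m)) (y : Bits n) :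
    D.eval z (Fin.append y 0 : Bits (n + m))
      = V (fun i => z (Fin.castAdd m i)) y * ketZero m (fun j => z (Fin.natAdd n j)) := by
  have := congrFun (h (Pi.single y 1)) z
  rwa [tensorVec_single_ketZero, mulVec_single_one, mulVec_single_one, Matrix.col_apply] at this

theorem Represents.eval_append_append {D : Circuit toffoliHadamard (n + m)} {V : QMat n}
    (h : Represents D V) (x y : Bits n) :
    D.eval (Fin.append x 0 : Bits (n + m)) (Fin.append y 0 : Bits (n + m)) = V x y := by
  rw [h.eval_apply]
  simp only [Fin.append_left, Fin.append_right]
  have : ketZero m (fun _ => (0 : Bits m) _) = 1 := Pi.single_eq_same _ _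
  exact (congrArg _ this).trans (mul_one _)

/-- Columns of the circuit matrix with zero ancilla input vanish on rows with nonzero ancilla
output. Their inner products are thus those of the columns of `V`. -/
theorem Represents.mem_unitaryGroup {D : Circuit toffoliHadamard (n + m)} {V : QMat n}
    (h : Represents D V) : V ∈ unitaryGroup (Bits n) ℂ := by
  rw [mem_unitaryGroup_iff']
  ext x y
  have hD := congrFun (congrFun (mem_unitaryGroup_iff'.1 D.eval_properties.1)
    (Fin.append x 0 : Bits (n + m))) (Fin.append y 0 : Bits (n + m))
  have hinj : Function.Injective fun u : Bits n => (Fin.append u 0 : Bits (n + m)) :=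
    append_injective_left _
  have hone : (1 : QMat (n + m)) (Fin.append x 0 : Bits (n + m)) (Fin.append y 0 : Bits (n + m))
      = (1 : QMat n) x y := by
    rw [Matrix.one_apply, Matrix.one_apply]
    congr 1
    exact propext hinj.eq_iff
  rw [hone] at hD
  rw [← hD, Matrix.mul_apply, Matrix.mul_apply]
  refine Finset.sum_of_injOn (fun u => (Fin.append u 0 : Bits (n + m))) hinj.injOn (by simp) ?_ ?_
  · intro z _ hz
    have hz' : (fun j => z (Fin.natAdd n j)) ≠ (0 : Bits m) := fun h0 =>
      hz ⟨fun i => z (Fin.castAdd m i), by simp, by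
        simp only []
        rw [← h0, append_castAdd_natAdd]⟩
    rw [h.eval_apply, ketZero, Pi.single_eq_of_ne hz', mul_zero, mul_zero]
  · intro u _
    rw [star_apply, star_apply, h.eval_append_append, h.eval_append_append]

theorem Represents.isIntMatrixDivSqrtTwoPow {D : Circuit toffoliHadamard (n + m)} {V : QMat n}
    (h : Represents D V) : ∃ q, IsIntMatrixDivSqrtTwoPow V q := by
  obtain ⟨q, W, hW⟩ := D.eval_properties.2
  refine ⟨q, W.submatrix (fun x => Fin.append x 0) (fun x => Fin.append x 0), ?_⟩
  ext x y
  rw [← h.eval_append_append, hW]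
  rfl

end Ancillas

/-! ### Odd dimension: the determinant -/

theorem int_sq_ne_two_pow_odd (a : ℤ) {r : ℕ} (hr : Odd r) : a ^ 2 ≠ 2 ^ r := by
  intro h
  have h' : a.natAbs ^ 2 = 2 ^ r := by
    zify
    rwa [sq_abs]
  obtain ⟨s, -, hs⟩ := (Nat.dvd_prime_pow Nat.prime_two).1 (h' ▸ dvd_pow_self a.natAbs two_ne_zero)
  rw [hs, ← pow_mul] at h'
  have := Nat.pow_right_injective le_rfl h'
  obtain ⟨t, rfl⟩ := hr
  omega

theorem not_odd_of_odd_dimension {d : ℕ} (hd : Odd d) {V : Matrix (Fin d) (Fin d) ℂ}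
    (hV : V ∈ unitaryGroup (Fin d) ℂ) {q : ℕ} (hq : IsIntMatrixDivSqrtTwoPow V q) : ¬ Odd q := by
  intro hodd
  obtain ⟨W, hW⟩ := hq
  have hdet : V.det = (W.det : ℂ) / (Real.sqrt 2 : ℂ) ^ (q * d) := by
    have : (W.map fun a : ℤ => (a : ℂ)).det = (W.det : ℂ) := ((Int.castRingHom ℂ).map_det W).symm
    rw [hW, det_smul, this, Fintype.card_fin, div_pow, one_pow, ← pow_mul, one_div_mul_eq_div]
  have h := (Unitary.mem_iff.1 (det_of_mem_unitary hV)).1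
  have hstar : star V.det = V.det := by
    rw [hdet, star_div₀, star_pow, star_intCast]
    simp
  rw [hstar, hdet, div_mul_div_comm, ← mul_pow, sqrtTwo_mul_self,
    div_eq_one_iff_eq (pow_ne_zero _ two_ne_zero), ← pow_two] at h
  exact int_sq_ne_two_pow_odd W.det (hodd.mul hd) (by exact_mod_cast h)

end QCirc

theorem mainTheorem7 :
    -- the characterization
    (∀ (n : ℕ) (V : QCirc.QMat n),
      QCirc.Representable QCirc.toffoliHadamard V ↔
        V ∈ Matrix.unitaryGroup (QCirc.Bits n) ℂ ∧ ∃ q : ℕ, QCirc.IsIntMatrixDivSqrtTwoPow V q) ∧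
    -- a single ancilla suffices
    (∀ (n : ℕ) (V : QCirc.QMat n),
      QCirc.Representable QCirc.toffoliHadamard V →
        QCirc.RepresentableWith QCirc.toffoliHadamard 1 V) ∧
    -- in odd dimension the exponent is never odd
    (∀ (d : ℕ), Odd d → ∀ V ∈ Matrix.unitaryGroup (Fin d) ℂ, ∀ q : ℕ,
      QCirc.IsIntMatrixDivSqrtTwoPow V q → ¬ Odd q) := by
  refine ⟨fun n V => ⟨?_, ?_⟩, ?_, ?_⟩
  · rintro ⟨m, D, hD⟩
    exact ⟨hD.mem_unitaryGroup, hD.isIntMatrixDivSqrtTwoPow⟩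
  · rintro ⟨hV, q, hq⟩
    exact ⟨1, QCirc.representableWith_one hV hq⟩
  · rintro n V ⟨m, D, hD⟩
    obtain ⟨q, hq⟩ := hD.isIntMatrixDivSqrtTwoPow
    exact QCirc.representableWith_one hD.mem_unitaryGroup hq
  · exact fun d hd V hV q hq => QCirc.not_odd_of_odd_dimension hd hV hq
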